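/- **Setting.** Let $\Omega_X,\Omega_M$ be separable metric spaces (with their Borel $\sigma$-algebras), let $\kappa_X,\kappa_M$ be bounded continuous positive semidefinite real kernels on them, with reproducing kernel Hilbert spaces $\mathcal X,\mathcal M$, and let $\mathcal Z$ be the reproducing kernel Hilbert space on $\Omega_X\times\Omega_M$ of the kernel $\kappa_Z((x,m),(x',m'))=\kappa_X(x,x')+\kappa_M(m,m')$. Let $(X,M)$ be a random element of $\Omega_X\times\Omega_M$, put $Z=(X,M)$, and let $Z_i=(X_i,M_i)$, $i=1,2,\dots$, be i.i.d. copies of $Z$. Put $\mu_X=\mathbb E[\kappa_X(\cdot,X)]$, $\mu_Z=\mathbb E[\kappa_Z(\cdot,Z)]$, $$\Sigma_{XX}=\mathbb E[(\kappa_X(\cdot,X)-\mu_X)\otimes(\kappa_X(\cdot,X)-\mu_X)],\qquad \Sigma_{ZZ}=\mathbb E[(\kappa_Z(\cdot,Z)-\mu_Z)\otimes(\kappa_Z(\cdot,Z)-\mu_Z)],$$ and suppose that both operators have infinite rank. Let $(\lambda_j,\varphi_j)_{j\ge1}$ and $(\tilde\lambda_j,\tilde\varphi_j)_{j\ge1}$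 be the eigenpairs of $\Sigma_{XX}$ and of $\Sigma_{ZZ}$ with positive eigenvalues, listed in descending order with multiplicity and with orthonormal eigenvectors. Let $\epsilon=\epsilon_n>0$ and $\tilde\epsilon=\tilde\epsilon_n>0$ be deterministic sequences. For $f\in\mathcal Z$ and $g\in\mathcal X$ define $$\vartheta_n^Z[f]=\sum_{j}\frac{\tilde\lambda_j\langle\tilde\varphi_j,f\rangle^2}{(\tilde\lambda_j+\tilde\epsilon)^{2}},\qquad \vartheta_n^X[g]=\sum_{j}\frac{\lambda_j\langle\varphi_j,g\rangle^2}{(\lambda_j+\epsilon)^{2}} .$$ With $\hat\mu_X=\frac1n\sum_{i=1}^n\kappa_X(\cdot,X_i)$, $\hat\Sigma_{XX}=\frac1n\sum_{i=1}^n(\kappa_X(\cdot,X_i)-\hat\mu_X)\otimes(\kappa_X(\cdot,X_i)-\hat\mu_X)$, $\hat\Sigma_{XX}^\dagger=(\hat\Sigma_{XX}+\epsilon I)^{-1}$, the analogous $\hat\mu_Z,\hat\Sigma_{ZZ}$, and $\hat\Sigma_{ZZ}^\dagger=(\hat\Sigma_{ZZ}+\tilde\epsilon I)^{-1}$, define $$\hat\vartheta_n^Z[f]=\frac1n\sum_{i=1}^n\langle\hat\Sigma_{ZZ}^\dagger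 f,\kappa_Z(\cdot,Z_i)-\hat\mu_Z\rangle^2,\qquad \hat\vartheta_n^X[g]=\frac1n\sum_{i=1}^n\langle\hat\Sigma_{XX}^\dagger g,\kappa_X(\cdot,X_i)-\hat\mu_X\rangle^2 .$$ **Claim.** Let $\eta,\tilde\eta\in(0,1]$. Suppose that $\epsilon\to0$, $\tilde\epsilon\to0$, $n^{-1/2}=o(\epsilon)$, $n^{-1/2}=o(\tilde\epsilon)$, $n^{-3/(4\eta+4)}=O(\epsilon)$ and $n^{-3/(4\tilde\eta+4)}=O(\tilde\epsilon)$. Let $f\in\mathcal Z$ and $g\in\mathcal X$ satisfy $\vartheta_n^Z[f]>0$ and $\vartheta_n^X[g]>0$ for all $n$. Then, as $n\to\infty$, $$\frac{\hat\vartheta_n^Z[f]}{\vartheta_n^Z[f]}\overset{P}{\longrightarrow}1\qquad\text{and}\qquad\frac{\hat\vartheta_n^X[g]}{\vartheta_n^X[g]}\overset{P}{\longrightarrow}1 .$$ -/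

import Mathlib

open MeasureTheory ProbabilityTheory Filter Asymptotics
open scoped Topology

noncomputable section

namespace KernelScale

/-- The real-valued function `κ` is the reproducing kernel of the (real, scalar) reproducing kernel
Hilbert space `H` on `S`; Mathlib's kernel takes values in the operators on `ℝ`. -/
def Generates {S : Type*} (κ : S → S → ℝ) (H : Type*) [NormedAddCommGroup H]
    [InnerProductSpace ℝ H] [CompleteSpace H] [RKHS ℝ H S ℝ] : Prop :=
  ∀ x y : S, RKHS.kernel H x y (1 : ℝ) = κ x y

/-- The feature map `s ↦ κ(·, s)` of a reproducing kernel Hilbert space on `S`. -/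
def feature {S : Type*} (H : Type*) [NormedAddCommGroup H]
    [InnerProductSpace ℝ H] [CompleteSpace H] [RKHS ℝ H S ℝ] (s : S) : H :=
  RKHS.kerFun H s (1 : ℝ)

/-- The kernel `((x, m), (x', m')) ↦ κX x x' + κM m m'` on the product space. -/
def sumKernel {S T : Type*} (κX : S → S → ℝ) (κM : T → T → ℝ) : S × T → S × T → ℝ :=
  fun z z' => κX z.1 z'.1 + κM z.2 z'.2

section Hilbert

variable {Ω : Type*} {H : Type*} [NormedAddCommGroup H] [InnerProductSpace ℝ H]

/-- The covariance operator `E[(ξ - E ξ) ⊗ (ξ - E ξ)]`, a Bochner integral of operators. -/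
def covOp [MeasurableSpace Ω] (P : Measure Ω) (ξ : Ω → H) : H →L[ℝ] H :=
  ∫ ω, InnerProductSpace.rankOne ℝ (ξ ω - ∫ ω', ξ ω' ∂P) (ξ ω - ∫ ω', ξ ω' ∂P) ∂P

/-- `(lam j, φ j)`, `j ∈ ℕ`, are the eigenpairs of `A` with positive eigenvalue: the eigenvalues are
listed in descending order with multiplicity, the eigenvectors are orthonormal, and
`A = ∑ j, lam j • (φ j ⊗ φ j)`. -/
structure IsSpectralDecomposition (A : H →L[ℝ] H) (lam : ℕ → ℝ) (φ : ℕ → H) : Prop where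
  antitone : Antitone lam
  pos : ∀ j, 0 < lam j
  orthonormal : Orthonormal ℝ φ
  eigen : ∀ j, A (φ j) = lam j • φ j
  hasSum : ∀ h : H, HasSum (fun j => (lam j * inner ℝ (φ j) h) • φ j) (A h)

/-- The population scale functional `∑ j, (lam j + ε)⁻² * lam j * ⟨φ j, f⟩²`. -/
def scale (lam : ℕ → ℝ) (φ : ℕ → H) (ε : ℝ) (f : H) : ℝ :=
  ∑' j, ((lam j + ε) ^ 2)⁻¹ * lam j * (inner ℝ (φ j) f) ^ 2

/-- The empirical mean of the first `n` elements of the sample `ξ 0, ξ 1, …`. -/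
def empMean (ξ : ℕ → Ω → H) (n : ℕ) (ω : Ω) : H :=
  (n : ℝ)⁻¹ • ∑ i ∈ Finset.range n, ξ i ω

/-- The empirical covariance operator of the first `n` elements of the sample. -/
def empCovOp (ξ : ℕ → Ω → H) (n : ℕ) (ω : Ω) : H →L[ℝ] H :=
  (n : ℝ)⁻¹ • ∑ i ∈ Finset.range n,
    InnerProductSpace.rankOne ℝ (ξ i ω - empMean ξ n ω) (ξ i ω - empMean ξ n ω)

/-- The Tikhonov-regularized inverse `(A + ε I)⁻¹`. It is applied to positive semidefinite `A` and
`ε > 0`, where `A + ε I` is invertible. -/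
def tikhonovInv (A : H →L[ℝ] H) (ε : ℝ) : H →L[ℝ] H :=
  Ring.inverse (A + ε • (1 : H →L[ℝ] H))

/-- The empirical scale functional `E_n[⟨(Σ̂ + ε I)⁻¹ f, ξ i - μ̂⟩²]`. -/
def empScale (ξ : ℕ → Ω → H) (ε : ℝ) (n : ℕ) (f : H) (ω : Ω) : ℝ :=
  (n : ℝ)⁻¹ * ∑ i ∈ Finset.range n,
    (inner ℝ (tikhonovInv (empCovOp ξ n ω) ε f) (ξ i ω - empMean ξ n ω)) ^ 2

end Hilbert

end KernelScale

end

/-! Write `A` for the covariance operator, `B` for the empirical one, `u = (A + εI)⁻¹ f`, `v = (B +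
εI)⁻¹ f`. Both functionals are quadratic forms: the population scale `θ` is `⟨A u, u⟩`
(`hasSum_scale`) and the empirical one is `⟨B v, v⟩` (`empScale_eq`). With `d = (B - A) u`, a
deterministic resolvent estimate (`abs_inner_tikhonovInv_sub_le`) bounds their difference by `3 ‖f‖
‖d‖ / ε + ‖d‖² / ε`. The perturbation enters only through its action on the fixed vector `u`, and `E
‖d‖²` is at most a constant times `θ / n` (`exists_integrable_norm_empCovOp_sub_sq_le`). Hence the
relative error is of order `‖f‖ / (ε √(n θ)) + 1 / (n ε)` in probability. It vanishes because
`n^(-1/2) = o(ε)`, `ε` is bounded and `θ` stays away from zero (`exists_pos_le_scale`). -/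

noncomputable section

namespace KernelScale

section Operators

variable {H : Type*} [NormedAddCommGroup H] [InnerProductSpace ℝ H]

/-! ### Regularized inverses of positive operators. -/

section Tikhonov

variable [CompleteSpace H] {A B : H →L[ℝ] H} {ε : ℝ}

theorem isUnit_add_smul_one (hA : ∀ x, 0 ≤ inner ℝ (A x) x) (hε : 0 < ε) :
    IsUnit (A + ε • (1 : H →L[ℝ] H)) := by
  refine ContinuousLinearMap.isUnit_of_forall_le_norm_inner_map _ (c := ⟨ε, hε.le⟩) hε fun x => ?_
  have h : inner ℝ ((A + ε • (1 : H →L[ℝ] H)) x) x = inner ℝ (A x) x + ε * ‖x‖ ^ 2 := by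
    simp [inner_add_left, inner_smul_left]
  rw [h]
  refine le_trans ?_ (le_abs_self _)
  change ‖x‖ ^ 2 * ε ≤ _
  linarith [hA x]

theorem apply_tikhonovInv (hA : ∀ x, 0 ≤ inner ℝ (A x) x) (hε : 0 < ε) (x : H) :
    A (tikhonovInv A ε x) + ε • tikhonovInv A ε x = x := by
  have h := Ring.mul_inverse_cancel _ (isUnit_add_smul_one hA hε)
  simpa [tikhonovInv] using DFunLike.congr_fun h x

theorem tikhonovInv_eq (hA : ∀ x, 0 ≤ inner ℝ (A x) x) (hε : 0 < ε) {x y : H}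
    (h : A y + ε • y = x) : tikhonovInv A ε x = y := by
  have h' := Ring.inverse_mul_cancel _ (isUnit_add_smul_one hA hε)
  simpa [tikhonovInv, h] using DFunLike.congr_fun h' y

/-- Expands the square of `x = A u + ε u`. All three terms are nonnegative, so each of `‖A u‖` and
`ε ‖u‖` is at most `‖x‖`, with no appeal to symmetry of `A`. -/
theorem norm_sq_eq_tikhonovInv (hA : ∀ x, 0 ≤ inner ℝ (A x) x) (hε : 0 < ε) (x : H) :
    ‖x‖ ^ 2 = ‖A (tikhonovInv A ε x)‖ ^ 2
      + 2 * ε * inner ℝ (A (tikhonovInv A ε x)) (tikhonovInv A ε x)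
      + (ε * ‖tikhonovInv A ε x‖) ^ 2 := by
  conv_lhs => rw [← apply_tikhonovInv hA hε x, norm_add_sq_real, inner_smul_right, norm_smul,
    Real.norm_of_nonneg hε.le]
  ring

theorem norm_apply_tikhonovInv_le (hA : ∀ x, 0 ≤ inner ℝ (A x) x) (hε : 0 < ε) (x : H) :
    ‖A (tikhonovInv A ε x)‖ ≤ ‖x‖ := by
  refine le_of_sq_le_sq ?_ (norm_nonneg x)
  have := norm_sq_eq_tikhonovInv hA hε x
  have := mul_nonneg (mul_nonneg zero_le_two hε.le) (hA (tikhonovInv A ε x))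
  nlinarith [sq_nonneg (ε * ‖tikhonovInv A ε x‖)]

theorem norm_tikhonovInv_le (hA : ∀ x, 0 ≤ inner ℝ (A x) x) (hε : 0 < ε) (x : H) :
    ‖tikhonovInv A ε x‖ ≤ ‖x‖ / ε := by
  rw [le_div_iff₀ hε, mul_comm]
  refine le_of_sq_le_sq ?_ (norm_nonneg x)
  have := norm_sq_eq_tikhonovInv hA hε x
  have := mul_nonneg (mul_nonneg zero_le_two hε.le) (hA (tikhonovInv A ε x))
  nlinarith [sq_nonneg ‖A (tikhonovInv A ε x)‖]

/-- Perturbation of the quadratic form `⟨A u, u⟩` at `u = (A + ε I)⁻¹ f`. -/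
theorem abs_inner_tikhonovInv_sub_le (hA : ∀ x, 0 ≤ inner ℝ (A x) x)
    (hB : ∀ x, 0 ≤ inner ℝ (B x) x) (hBsymm : ∀ x y, inner ℝ (B x) y = inner ℝ x (B y))
    (hε : 0 < ε) (f : H) :
    |inner ℝ (B (tikhonovInv B ε f)) (tikhonovInv B ε f)
        - inner ℝ (A (tikhonovInv A ε f)) (tikhonovInv A ε f)|
      ≤ 3 * (‖f‖ / ε) * ‖B (tikhonovInv A ε f) - A (tikhonovInv A ε f)‖
        + ‖B (tikhonovInv A ε f) - A (tikhonovInv A ε f)‖ ^ 2 / ε := by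
  have hu := norm_tikhonovInv_le hA hε f
  have hAu := apply_tikhonovInv hA hε f
  set u := tikhonovInv A ε f
  set d := B u - A u with hd
  have hw := norm_tikhonovInv_le hB hε d
  have hBw := norm_apply_tikhonovInv_le hB hε d
  have hwd := apply_tikhonovInv hB hε d
  set w := tikhonovInv B ε d
  -- Resolvent identity: `(B + ε)(u - w) = B u + ε u - d = A u + ε u = f`.
  have hv : tikhonovInv B ε f = u - w := by
    refine tikhonovInv_eq hB hε ?_
    rw [map_sub, smul_sub, sub_add_sub_comm, hwd, hd, ← hAu]
    abel
  -- Symmetry puts `B` on `w` in both cross terms, where `‖B w‖ ≤ ‖d‖` costs no factor `1 / ε`. The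
  -- terms in `u` then account for the constant `3 = 1 + 2`.
  have key : inner ℝ (B (u - w)) (u - w) - inner ℝ (A u) u
      = inner ℝ d u - 2 * inner ℝ u (B w) + inner ℝ (B w) w := by
    rw [hd, map_sub, inner_sub_left, inner_sub_left, inner_sub_right, inner_sub_right, hBsymm u w,
      real_inner_comm u (B w)]
    ring
  have hu0 : 0 ≤ ‖f‖ / ε := by positivity
  have h1 : |inner ℝ d u| ≤ ‖f‖ / ε * ‖d‖ := by
    refine (abs_real_inner_le_norm _ _).trans ?_
    rw [mul_comm]
    gcongr
  have h2 : |inner ℝ u (B w)| ≤ ‖f‖ / ε * ‖d‖ := by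
    refine (abs_real_inner_le_norm _ _).trans ?_
    gcongr
  have h3 : |inner ℝ (B w) w| ≤ ‖d‖ ^ 2 / ε := by
    refine (abs_real_inner_le_norm _ _).trans ?_
    calc ‖B w‖ * ‖w‖ ≤ ‖d‖ * (‖d‖ / ε) := by gcongr
      _ = ‖d‖ ^ 2 / ε := by ring
  rw [hv, key]
  rw [abs_le] at *
  constructor <;> linarith [h1.1, h1.2, h2.1, h2.2, h3.1, h3.2]

end Tikhonov

/-! ### Spectral form of the population scale. -/

section Spectral

variable {A : H →L[ℝ] H} {lam : ℕ → ℝ} {φ : ℕ → H}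

theorem IsSpectralDecomposition.inner_apply (h : IsSpectralDecomposition A lam φ) (j : ℕ) (x : H) :
    inner ℝ (φ j) (A x) = lam j * inner ℝ (φ j) x := by
  have h1 := (h.hasSum x).mapL (innerSL ℝ (φ j))
  have h2 : HasSum (fun i => innerSL ℝ (φ j) ((lam i * inner ℝ (φ i) x) • φ i))
      (innerSL ℝ (φ j) ((lam j * inner ℝ (φ j) x) • φ j)) := by
    refine hasSum_single j fun i hi => ?_
    simp [h.orthonormal.2 (Ne.symm hi)]
  have h3 := h1.unique h2
  simpa [inner_smul_right, h.orthonormal.1 j] using h3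

theorem IsSpectralDecomposition.hasSum_inner (h : IsSpectralDecomposition A lam φ) (x : H) :
    HasSum (fun j => lam j * inner ℝ (φ j) x ^ 2) (inner ℝ (A x) x) := by
  have h1 := (h.hasSum x).mapL (innerSL ℝ x)
  rw [real_inner_comm]
  have hterm (j : ℕ) : innerSL ℝ x ((lam j * inner ℝ (φ j) x) • φ j)
      = lam j * inner ℝ (φ j) x ^ 2 := by
    rw [innerSL_apply_apply, inner_smul_right, real_inner_comm]
    ring
  simp only [hterm] at h1
  exact h1

/-- The `j`-th coordinate of `f` is `lam j + ε` times that of `(A + εI)⁻¹ f`; the component of `f`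
orthogonal to all `φ j` contributes to neither side. -/
theorem IsSpectralDecomposition.hasSum_scale [CompleteSpace H]
    (h : IsSpectralDecomposition A lam φ)
    (hA : ∀ x, 0 ≤ inner ℝ (A x) x) {ε : ℝ} (hε : 0 < ε) (f : H) :
    HasSum (fun j => ((lam j + ε) ^ 2)⁻¹ * lam j * inner ℝ (φ j) f ^ 2)
      (inner ℝ (A (tikhonovInv A ε f)) (tikhonovInv A ε f)) := by
  convert h.hasSum_inner (tikhonovInv A ε f) using 2 with j
  have hj := h.pos j
  have h1 : inner ℝ (φ j) f = (lam j + ε) * inner ℝ (φ j) (tikhonovInv A ε f) := by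
    conv_lhs => rw [← apply_tikhonovInv hA hε f]
    rw [inner_add_right, h.inner_apply, inner_smul_right]
    ring
  rw [h1]
  field_simp

/-- A scale functional which is positive for one regularization parameter is bounded away from
zero for all bounded regularization parameters. -/
theorem IsSpectralDecomposition.exists_pos_le_scale [CompleteSpace H]
    (h : IsSpectralDecomposition A lam φ) (hA : ∀ x, 0 ≤ inner ℝ (A x) x) {f : H} {ε₀ : ℝ}
    (hf : 0 < scale lam φ ε₀ f) (E : ℝ) :
    ∃ c > 0, ∀ ε, 0 < ε → ε ≤ E → c ≤ scale lam φ ε f := by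
  obtain ⟨j, hj⟩ : ∃ j, inner ℝ (φ j) f ≠ 0 := by
    by_contra! h0
    simp [scale, h0] at hf
  have hlam := h.pos j
  have hpos : 0 < lam j * inner ℝ (φ j) f ^ 2 := by positivity
  -- The witness is a single nonzero term of the series, taken at the largest admissible `ε`; `max E
  -- 0` keeps the denominator positive for every sign of `E`.
  refine ⟨((lam j + max E 0) ^ 2)⁻¹ * lam j * inner ℝ (φ j) f ^ 2, ?_, fun ε hε hεE => ?_⟩
  · positivity
  · refine le_trans ?_ ((h.hasSum_scale hA hε f).summable.le_tsum j fun i _ => ?_)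
    · have : ε ≤ max E 0 := hεE.trans (le_max_left _ _)
      gcongr
    · have := h.pos i
      positivity

end Spectral

/-! ### Algebra of the empirical covariance operator. -/

section Empirical

variable {Ω : Type*}

theorem inner_empCovOp {ξ : ℕ → Ω → H} (n : ℕ) (ω : Ω) (x y : H) :
    inner ℝ (empCovOp ξ n ω x) y = (n : ℝ)⁻¹ * ∑ i ∈ Finset.range n,
      inner ℝ x (ξ i ω - empMean ξ n ω) * inner ℝ y (ξ i ω - empMean ξ n ω) := by
  simp only [empCovOp, smul_apply, sum_apply, InnerProductSpace.rankOne_apply, inner_smul_left,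
    sum_inner, real_inner_comm]
  simp

theorem inner_empCovOp_self_nonneg {ξ : ℕ → Ω → H} (n : ℕ) (ω : Ω) (x : H) :
    0 ≤ inner ℝ (empCovOp ξ n ω x) x := by
  rw [inner_empCovOp]
  exact mul_nonneg (by positivity) (Finset.sum_nonneg fun i _ => mul_self_nonneg _)

theorem empScale_eq (ξ : ℕ → Ω → H) (ε : ℝ) (n : ℕ) (f : H) (ω : Ω) :
    empScale ξ ε n f ω = inner ℝ (empCovOp ξ n ω (tikhonovInv (empCovOp ξ n ω) ε f))
      (tikhonovInv (empCovOp ξ n ω) ε f) := by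
  rw [inner_empCovOp, empScale]
  simp_rw [sq]

/-- The empirical covariance operator in terms of variables centred at an arbitrary point. -/
theorem empCovOp_apply_eq {ξ : ℕ → Ω → H} {n : ℕ} (hn : n ≠ 0) (ω : Ω) (m u : H) :
    empCovOp ξ n ω u
      = (n : ℝ)⁻¹ • ∑ i ∈ Finset.range n, inner ℝ (ξ i ω - m) u • (ξ i ω - m)
        - ((n : ℝ)⁻¹ • ∑ i ∈ Finset.range n, inner ℝ (ξ i ω - m) u) •
          ((n : ℝ)⁻¹ • ∑ i ∈ Finset.range n, (ξ i ω - m)) := by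
  have hn' : (n : ℝ) ≠ 0 := by exact_mod_cast hn
  have hsub (i : ℕ) : ξ i ω - empMean ξ n ω
      = (ξ i ω - m) - (n : ℝ)⁻¹ • ∑ i ∈ Finset.range n, (ξ i ω - m) := by
    have : (n : ℝ)⁻¹ • (n : ℝ) • m = m := inv_smul_smul₀ hn' m
    rw [empMean, Finset.sum_sub_distrib, Finset.sum_const, Finset.card_range, smul_sub,
      ← Nat.cast_smul_eq_nsmul ℝ, this]
    abel
  simp only [empCovOp, smul_apply, sum_apply, InnerProductSpace.rankOne_apply, hsub]
  generalize hc : (fun i => ξ i ω - m) = c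
  have hc' (i : ℕ) : ξ i ω - m = c i := congrFun hc i
  simp only [hc']
  set b := (n : ℝ)⁻¹ • ∑ i ∈ Finset.range n, c i with hb
  have hsum : ∑ i ∈ Finset.range n, c i = (n : ℝ) • b := by
    rw [hb, smul_inv_smul₀ hn']
  have hin : ∑ i ∈ Finset.range n, inner ℝ (c i) u = n * inner ℝ b u := by
    rw [← sum_inner, hsum, inner_smul_left]
    rfl
  simp only [inner_sub_left _ b, sub_smul, smul_sub, Finset.sum_sub_distrib, ← Finset.smul_sum,
    ← Finset.sum_smul, hsum, hin, Finset.sum_const, Finset.card_range,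
    ← Nat.cast_smul_eq_nsmul ℝ, smul_smul, smul_eq_mul]
  match_scalars
  all_goals field_simp
  ring

end Empirical

end Operators

/-! ### Second moments of sample averages in a Hilbert space. -/

section Sampling

theorem norm_sub_mean_le {Ω : Type*} [MeasurableSpace Ω] {P : Measure Ω} [IsProbabilityMeasure P]
    {T : Type*} {Z : Ω → T} {H : Type*} [NormedAddCommGroup H] [InnerProductSpace ℝ H] {Φ : T → H}
    {B : ℝ} (hB : ∀ t, ‖Φ t‖ ≤ B) (t : T) :
    ‖Φ t - ∫ ω, Φ (Z ω) ∂P‖ ≤ 2 * B := by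
  have : ‖∫ ω, Φ (Z ω) ∂P‖ ≤ B := by
    simpa using norm_integral_le_of_norm_le_const (μ := P) (.of_forall fun ω => hB (Z ω))
  linarith [norm_sub_le (Φ t) (∫ ω, Φ (Z ω) ∂P), hB t]

theorem integral_comp_eq_of_identDistrib {Ω : Type*} [MeasurableSpace Ω] {P : Measure Ω}
    {T : Type*} [MeasurableSpace T] {E : Type*} [NormedAddCommGroup E]
    [NormedSpace ℝ E] {Y Z : Ω → T} (hYZ : IdentDistrib Y Z P P) {F : T → E}
    (hF : StronglyMeasurable F) : ∫ ω, F (Y ω) ∂P = ∫ ω, F (Z ω) ∂P := by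
  rw [← integral_map hYZ.aemeasurable_fst hF.aestronglyMeasurable, hYZ.map_eq,
    integral_map hYZ.aemeasurable_snd hF.aestronglyMeasurable]

variable {Ω : Type*} [MeasurableSpace Ω] {P : Measure Ω} [IsProbabilityMeasure P]
  {T : Type*} [MeasurableSpace T] {Z : Ω → T} {Zs : ℕ → Ω → T}
  {H : Type*} [NormedAddCommGroup H] [InnerProductSpace ℝ H] [CompleteSpace H]

theorem integrable_comp_of_norm_le {E : Type*} [NormedAddCommGroup E] {F : T → E}
    (hF : StronglyMeasurable F) {K : ℝ} (hK : ∀ t, ‖F t‖ ≤ K) {Y : Ω → T} (hY : Measurable Y) :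
    Integrable (fun ω => F (Y ω)) P :=
  Integrable.of_bound (hF.comp_measurable hY).aestronglyMeasurable K (.of_forall fun _ => hK _)

theorem integrable_norm_sq_mean (hZs : ∀ i, Measurable (Zs i)) {E : Type*} [NormedAddCommGroup E]
    [NormedSpace ℝ E] {F : T → E} (hF : StronglyMeasurable F) {K : ℝ} (hK : ∀ t, ‖F t‖ ≤ K)
    (n : ℕ) :
    Integrable (fun ω => ‖(n : ℝ)⁻¹ • ∑ i ∈ Finset.range n, F (Zs i ω)‖ ^ 2) P := by
  have hmeas : StronglyMeasurable fun ω => ∑ i ∈ Finset.range n, F (Zs i ω) :=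
    Finset.stronglyMeasurable_fun_sum _ fun i _ => hF.comp_measurable (hZs i)
  refine Integrable.of_bound ((hmeas.const_smul _).norm.pow 2).aestronglyMeasurable
    (((n : ℝ)⁻¹ * (n * K)) ^ 2) (.of_forall fun ω => ?_)
  rw [norm_pow, norm_norm, norm_smul, norm_inv, Real.norm_natCast]
  gcongr
  simpa using norm_sum_le_of_le (Finset.range n) fun i _ => hK (Zs i ω)

theorem integral_norm_sub_integral_sq_le (hZ : Measurable Z) {F : T → H}
    (hF : StronglyMeasurable F) {K : ℝ} (hK : ∀ t, ‖F t‖ ≤ K) :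
    ∫ ω, ‖F (Z ω) - ∫ ω', F (Z ω') ∂P‖ ^ 2 ∂P ≤ ∫ ω, ‖F (Z ω)‖ ^ 2 ∂P := by
  have hint := integrable_comp_of_norm_le (P := P) hF hK hZ
  have hin := integral_inner (𝕜 := ℝ) hint (∫ ω', F (Z ω') ∂P)
  have hini := hint.const_inner (𝕜 := ℝ) (∫ ω', F (Z ω') ∂P)
  set m := ∫ ω', F (Z ω') ∂P
  have hsq : Integrable (fun ω => ‖F (Z ω)‖ ^ 2) P :=
    integrable_comp_of_norm_le (F := fun t => ‖F t‖ ^ 2) (K := K ^ 2) (hF.norm.pow 2)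
      (fun t => by rw [norm_pow, norm_norm]; gcongr; exact hK t) hZ
  simp_rw [norm_sub_sq_real, real_inner_comm m]
  rw [integral_add (f := fun ω => ‖F (Z ω)‖ ^ 2 - 2 * inner ℝ m (F (Z ω)))
      (hsq.sub (hini.const_mul 2)) (integrable_const _),
    integral_sub hsq (hini.const_mul 2), integral_const_mul, hin, real_inner_self_eq_norm_sq]
  simp only [integral_const, probReal_univ, one_smul]
  nlinarith [sq_nonneg ‖m‖]

/-- The second moment of the mean of i.i.d. centred bounded Hilbert space valued variables. -/
theorem integral_norm_sq_mean (hZs : ∀ i, Measurable (Zs i))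
    (hindep : iIndepFun Zs P) (hident : ∀ i, IdentDistrib (Zs i) Z P P)
    {F : T → H} (hF : StronglyMeasurable F) {K : ℝ} (hK : ∀ t, ‖F t‖ ≤ K)
    (h0 : ∫ ω, F (Z ω) ∂P = 0) (n : ℕ) :
    ∫ ω, ‖(n : ℝ)⁻¹ • ∑ i ∈ Finset.range n, F (Zs i ω)‖ ^ 2 ∂P
      = (n : ℝ)⁻¹ * ∫ ω, ‖F (Z ω)‖ ^ 2 ∂P := by
  have hint (i j : ℕ) : Integrable (fun ω => inner ℝ (F (Zs i ω)) (F (Zs j ω))) P := by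
    refine Integrable.of_bound (C := K * K) ?_ (.of_forall fun ω => ?_)
    · exact ((hF.comp_measurable (hZs i)).inner (hF.comp_measurable (hZs j))).aestronglyMeasurable
    · refine (norm_inner_le_norm _ _).trans ?_
      have := (norm_nonneg _).trans (hK (Zs i ω))
      gcongr <;> exact hK _
  -- Independence and centring kill the off-diagonal terms, so `n` of the `n²` inner products
  -- survive.
  have hcross (i j : ℕ) : ∫ ω, inner ℝ (F (Zs i ω)) (F (Zs j ω)) ∂P
      = if i = j then ∫ ω, ‖F (Z ω)‖ ^ 2 ∂P else 0 := by
    split_ifs with hij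
    · subst hij
      simp_rw [real_inner_self_eq_norm_sq]
      exact integral_comp_eq_of_identDistrib (F := fun t => ‖F t‖ ^ 2) (hident i) (hF.norm.pow 2)
    · have hb (i : ℕ) : Integrable F (P.map (Zs i)) :=
        (integrable_map_measure hF.aestronglyMeasurable (hZs i).aemeasurable).2
          (integrable_comp_of_norm_le hF hK (hZs i))
      have : ∫ ω, inner ℝ (F (Zs i ω)) (F (Zs j ω)) ∂P
          = inner ℝ (∫ ω, F (Zs i ω) ∂P) (∫ ω, F (Zs j ω) ∂P) :=
        (hindep.indepFun hij).integral_bilin_comp_comp (𝕜 := ℝ) (hZs i).aemeasurable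
        (hZs j).aemeasurable (hb i) (hb j) (innerSL ℝ)
      rw [this, integral_comp_eq_of_identDistrib (hident i) hF, h0, inner_zero_left]
  have hexp (ω : Ω) : ‖(n : ℝ)⁻¹ • ∑ i ∈ Finset.range n, F (Zs i ω)‖ ^ 2
      = ((n : ℝ)⁻¹) ^ 2 * ∑ i ∈ Finset.range n, ∑ j ∈ Finset.range n,
        inner ℝ (F (Zs i ω)) (F (Zs j ω)) := by
    rw [norm_smul, mul_pow, ← real_inner_self_eq_norm_sq (∑ i ∈ Finset.range n, F (Zs i ω)),
      sum_inner]
    simp_rw [inner_sum]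
    simp
  simp_rw [hexp]
  rw [integral_const_mul, integral_finsetSum _ fun i _ => integrable_finsetSum _ fun j _ => hint i j]
  simp_rw [integral_finsetSum _ fun j _ => hint _ j, hcross]
  simp only [Finset.sum_ite_eq, Finset.sum_ite_mem, Finset.inter_self, Finset.sum_const,
    Finset.card_range, nsmul_eq_mul]
  rcases eq_or_ne n 0 with rfl | hn
  · simp
  · field_simp

variable {Φ : T → H} {B : ℝ}

theorem covOp_apply (hΦ : StronglyMeasurable Φ) (hB : ∀ t, ‖Φ t‖ ≤ B) (hZ : Measurable Z) (u : H) :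
    covOp P (fun ω => Φ (Z ω)) u
      = ∫ ω, inner ℝ (Φ (Z ω) - ∫ ω', Φ (Z ω') ∂P) u • (Φ (Z ω) - ∫ ω', Φ (Z ω') ∂P) ∂P := by
  have hc := hΦ.sub (stronglyMeasurable_const (b := ∫ ω', Φ (Z ω') ∂P))
  rw [covOp, ContinuousLinearMap.integral_apply]
  · rfl
  · refine integrable_comp_of_norm_le (F := fun t => InnerProductSpace.rankOne ℝ
      (Φ t - ∫ ω', Φ (Z ω') ∂P) (Φ t - ∫ ω', Φ (Z ω') ∂P)) (K := 2 * B * (2 * B)) ?_ (fun t => ?_) hZ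
    · have hcont : Continuous fun x : H => InnerProductSpace.rankOne ℝ x x := 
        (InnerProductSpace.rankOne ℝ).continuous.clm_apply continuous_id
      exact hcont.comp_stronglyMeasurable hc
    · rw [InnerProductSpace.norm_rankOne]
      have := norm_sub_mean_le (P := P) (Z := Z) hB t
      have := (norm_nonneg _).trans this
      gcongr

theorem integrable_inner_smul (hΦ : StronglyMeasurable Φ) (hB : ∀ t, ‖Φ t‖ ≤ B)
    (hZ : Measurable Z) (u : H) :
    Integrable (fun ω => inner ℝ (Φ (Z ω) - ∫ ω', Φ (Z ω') ∂P) u •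
      (Φ (Z ω) - ∫ ω', Φ (Z ω') ∂P)) P := by
  have hc := hΦ.sub (stronglyMeasurable_const (b := ∫ ω', Φ (Z ω') ∂P))
  refine integrable_comp_of_norm_le (F := fun t => inner ℝ (Φ t - ∫ ω', Φ (Z ω') ∂P) u •
    (Φ t - ∫ ω', Φ (Z ω') ∂P)) (K := 2 * B * ‖u‖ * (2 * B))
    ((hc.inner stronglyMeasurable_const).smul hc) (fun t => ?_) hZ
  have ht := norm_sub_mean_le (P := P) (Z := Z) hB t
  have := (norm_nonneg _).trans ht
  rw [norm_smul]
  gcongr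
  refine (norm_inner_le_norm _ _).trans ?_
  gcongr

theorem inner_covOp (hΦ : StronglyMeasurable Φ) (hB : ∀ t, ‖Φ t‖ ≤ B) (hZ : Measurable Z) (u : H) :
    inner ℝ (covOp P (fun ω => Φ (Z ω)) u) u
      = ∫ ω, inner ℝ (Φ (Z ω) - ∫ ω', Φ (Z ω') ∂P) u ^ 2 ∂P := by
  rw [covOp_apply hΦ hB hZ, real_inner_comm, ← integral_inner (integrable_inner_smul hΦ hB hZ u)]
  refine integral_congr_ae (.of_forall fun ω => ?_)
  simp only [inner_smul_right, real_inner_comm u]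
  ring

/-- A second moment bound for `‖(Σ̂ - Σ) u‖` with respect to the quadratic form of `Σ` at `u`. -/
theorem exists_integrable_norm_empCovOp_sub_sq_le (hΦ : StronglyMeasurable Φ)
    (hB : ∀ t, ‖Φ t‖ ≤ B) (hZ : Measurable Z) (hZs : ∀ i, Measurable (Zs i))
    (hindep : iIndepFun Zs P) (hident : ∀ i, IdentDistrib (Zs i) Z P P)
    {n : ℕ} (hn : n ≠ 0) (u : H) :
    ∃ V : Ω → ℝ, Integrable V P ∧
      (∀ ω, ‖empCovOp (fun i ω => Φ (Zs i ω)) n ω u - covOp P (fun ω => Φ (Z ω)) u‖ ^ 2 ≤ V ω) ∧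
      ∫ ω, V ω ∂P ≤ 4 * (2 * B) ^ 2 * (n : ℝ)⁻¹ * inner ℝ (covOp P (fun ω => Φ (Z ω)) u) u := by
  have hn' : (n : ℝ) ≠ 0 := by exact_mod_cast hn
  have hcK := norm_sub_mean_le (P := P) (Z := Z) hB
  have hS := covOp_apply (P := P) hΦ hB hZ u
  have hθ := inner_covOp (P := P) hΦ hB hZ u
  have hint := integrable_inner_smul (P := P) hΦ hB hZ u
  set S := covOp P (fun ω => Φ (Z ω)) u
  have hm : ∫ ω, (Φ (Z ω) - ∫ ω', Φ (Z ω') ∂P) ∂P = 0 := by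
    rw [integral_sub (integrable_comp_of_norm_le hΦ hB hZ) (integrable_const _)]
    simp
  have hint0 : Integrable (fun ω => Φ (Z ω) - ∫ ω', Φ (Z ω') ∂P) P :=
    (integrable_comp_of_norm_le hΦ hB hZ).sub (integrable_const _)
  set m := ∫ ω', Φ (Z ω') ∂P
  set K := 2 * B
  have hK0 : 0 ≤ K := (norm_nonneg _).trans (hcK (Z (P.nonempty_of_neZero.some)))
  have hc : StronglyMeasurable fun t => Φ t - m := hΦ.sub stronglyMeasurable_const
  have hl : StronglyMeasurable fun t => inner ℝ (Φ t - m) u := hc.inner stronglyMeasurable_const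
  have hlK (t : T) : ‖inner ℝ (Φ t - m) u‖ ≤ K * ‖u‖ := by
    refine (norm_inner_le_norm _ _).trans ?_
    gcongr
    exact hcK t
  have hG : StronglyMeasurable fun t => inner ℝ (Φ t - m) u • (Φ t - m) - S :=
    (hl.smul hc).sub stronglyMeasurable_const
  have hGK (t : T) : ‖inner ℝ (Φ t - m) u • (Φ t - m) - S‖ ≤ K * ‖u‖ * K + ‖S‖ := by
    refine (norm_sub_le _ _).trans ?_
    rw [norm_smul]
    gcongr
    exacts [hlK t, hcK t]
  have hG0 : ∫ ω, (inner ℝ (Φ (Z ω) - m) u • (Φ (Z ω) - m) - S) ∂P = 0 := by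
    rw [integral_sub hint (integrable_const _), ← hS]
    simp
  have hl0 : ∫ ω, inner ℝ (Φ (Z ω) - m) u ∂P = 0 := by
    have := integral_inner (𝕜 := ℝ) hint0 u
    rw [hm, inner_zero_right] at this
    simpa only [real_inner_comm u] using this
  have hGsq := integral_norm_sq_mean hZs hindep hident hG hGK hG0 n
  have hlsq := integral_norm_sq_mean hZs hindep hident hl hlK hl0 n
  -- Only the vector factor is bounded by `K`; the scalar `⟨Φ - m, u⟩` is kept, so that its second
  -- moment `⟨S, u⟩` appears instead of `‖u‖²`. This is what later lets `θ` cancel.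
  have hsecond : ∫ ω, ‖inner ℝ (Φ (Z ω) - m) u • (Φ (Z ω) - m) - S‖ ^ 2 ∂P
      ≤ K ^ 2 * inner ℝ S u := by
    have h := integral_norm_sub_integral_sq_le (P := P) hZ
      (F := fun t => inner ℝ (Φ t - m) u • (Φ t - m)) (hl.smul hc)
      (K := K * ‖u‖ * K) fun t => by
        rw [norm_smul]
        gcongr
        exacts [hlK t, hcK t]
    rw [← hS] at h
    refine h.trans ?_
    rw [hθ, ← integral_const_mul]
    refine integral_mono_of_nonneg (.of_forall fun ω => sq_nonneg _) ?_ (.of_forall fun ω => ?_)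
    · refine (integrable_comp_of_norm_le (F := fun t => inner ℝ (Φ t - m) u ^ 2)
        (K := (K * ‖u‖) ^ 2) (hl.pow 2) (fun t => ?_) hZ).const_mul _
      rw [norm_pow]
      gcongr
      exact hlK t
    · simp only [norm_smul, mul_pow, Real.norm_eq_abs, sq_abs]
      rw [mul_comm]
      gcongr
      exact hcK _
  have hGint := integrable_norm_sq_mean (P := P) hZs hG hGK n
  have hlint := integrable_norm_sq_mean (P := P) hZs hl hlK n
  -- The deviation is a centred average minus the correction `y • b` from estimating the mean, with
  -- `‖b‖ ≤ K`; then `(p + q)² ≤ 2 p² + 2 q²`. Each part has expectation at most `2 K² ⟨S, u⟩ / n`,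
  -- whence the constant `4`.
  refine ⟨fun ω => 2 * ‖(n : ℝ)⁻¹ • ∑ i ∈ Finset.range n,
        (inner ℝ (Φ (Zs i ω) - m) u • (Φ (Zs i ω) - m) - S)‖ ^ 2
      + 2 * K ^ 2 * ‖(n : ℝ)⁻¹ • ∑ i ∈ Finset.range n, inner ℝ (Φ (Zs i ω) - m) u‖ ^ 2,
    (hGint.const_mul _).add (hlint.const_mul _), fun ω => ?_, ?_⟩
  · rw [empCovOp_apply_eq hn ω m u]
    have hb : ‖(n : ℝ)⁻¹ • ∑ i ∈ Finset.range n, (Φ (Zs i ω) - m)‖ ≤ K := by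
      rw [norm_smul, norm_inv, Real.norm_natCast, inv_mul_le_iff₀ (by positivity)]
      simpa using norm_sum_le_of_le (Finset.range n) fun i _ => hcK (Zs i ω)
    have hG' : (n : ℝ)⁻¹ • ∑ i ∈ Finset.range n, (inner ℝ (Φ (Zs i ω) - m) u • (Φ (Zs i ω) - m) - S)
        = (n : ℝ)⁻¹ • ∑ i ∈ Finset.range n, inner ℝ (Φ (Zs i ω) - m) u • (Φ (Zs i ω) - m) - S := by
      rw [Finset.sum_sub_distrib, Finset.sum_const, Finset.card_range, smul_sub,
        ← Nat.cast_smul_eq_nsmul ℝ, inv_smul_smul₀ hn']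
    simp only [hG']
    rw [sub_right_comm]
    set x := (n : ℝ)⁻¹ • ∑ i ∈ Finset.range n, inner ℝ (Φ (Zs i ω) - m) u • (Φ (Zs i ω) - m) - S
    set y := (n : ℝ)⁻¹ • ∑ i ∈ Finset.range n, inner ℝ (Φ (Zs i ω) - m) u
    set b := (n : ℝ)⁻¹ • ∑ i ∈ Finset.range n, (Φ (Zs i ω) - m)
    have hyb : ‖y • b‖ ≤ K * ‖y‖ := by
      rw [norm_smul, mul_comm]
      gcongr
    calc ‖x - y • b‖ ^ 2 ≤ (‖x‖ + K * ‖y‖) ^ 2 := by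
          gcongr
          exact (norm_sub_le _ _).trans (by gcongr)
      _ ≤ 2 * ‖x‖ ^ 2 + 2 * K ^ 2 * ‖y‖ ^ 2 := by nlinarith [sq_nonneg (‖x‖ - K * ‖y‖)]
  · rw [integral_add (hGint.const_mul _) (hlint.const_mul _),
      integral_const_mul, integral_const_mul, hGsq, hlsq]
    simp_rw [Real.norm_eq_abs, sq_abs]
    rw [← hθ]
    have := mul_le_mul_of_nonneg_left hsecond (show 0 ≤ 2 * (n : ℝ)⁻¹ by positivity)
    linarith

end Sampling

/-! ### Ratio consistency for a bounded feature map. -/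

section Consistency

variable {Ω : Type*} [MeasurableSpace Ω] {P : Measure Ω} [IsProbabilityMeasure P]
  {T : Type*} [MeasurableSpace T] {Z : Ω → T} {Zs : ℕ → Ω → T}
  {H : Type*} [NormedAddCommGroup H] [InnerProductSpace ℝ H] [CompleteSpace H]
  {Φ : T → H} {B : ℝ}

/-- Markov's inequality for `‖d‖²` combined with the resolvent estimate. Positivity of the scale at
one parameter suffices, since it already provides an eigenvector not orthogonal to `f`. -/
theorem tendstoInMeasure_empScale_div_scale (hΦ : StronglyMeasurable Φ) (hB : ∀ t, ‖Φ t‖ ≤ B)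
    (hZ : Measurable Z) (hZs : ∀ i, Measurable (Zs i))
    (hindep : iIndepFun Zs P) (hident : ∀ i, IdentDistrib (Zs i) Z P P)
    {lam : ℕ → ℝ} {φ : ℕ → H} (hspec : IsSpectralDecomposition (covOp P fun ω => Φ (Z ω)) lam φ)
    {ε : ℕ → ℝ} (hε_pos : ∀ n, 0 < ε n) (hε_zero : Tendsto ε atTop (𝓝 0))
    (hε_half : (fun n : ℕ => (n : ℝ) ^ (-(1 / 2) : ℝ)) =o[atTop] ε)
    {f : H} (hf : 0 < scale lam φ (ε 0) f) :
    TendstoInMeasure P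
      (fun n ω => empScale (fun i ω => Φ (Zs i ω)) (ε n) n f ω / scale lam φ (ε n) f)
      atTop (fun _ => (1 : ℝ)) := by
  have hpos (x : H) : 0 ≤ inner ℝ (covOp P (fun ω => Φ (Z ω)) x) x := by
    rw [inner_covOp hΦ hB hZ]
    exact integral_nonneg fun ω => sq_nonneg _
  obtain ⟨E, hE⟩ := hε_zero.bddAbove_range
  replace hE (n : ℕ) : ε n ≤ E := hE ⟨n, rfl⟩
  have hE0 : 0 < E := (hε_pos 0).trans_le (hE 0)
  obtain ⟨c, hc0, hc⟩ := hspec.exists_pos_le_scale hpos hf E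
  rw [tendstoInMeasure_iff_measureReal_norm]
  intro δ hδ
  -- On the event `‖d‖ ≤ r ε √θ` the relative error is at most `a r + r² E`; `r` is chosen to make
  -- this less than `δ`, the summand `1` in its denominator giving strictness.
  set a := 3 * ‖f‖ / √c with ha
  have ha0 : 0 ≤ a := by positivity
  set r := min 1 (δ / (a + E + 1)) with hr
  have hr0 : 0 < r := by positivity
  have hrδ : a * r + r ^ 2 * E < δ := by
    have h1 : r ≤ 1 := min_le_left _ _
    have h2 : r * (a + E + 1) ≤ δ := by
      rw [← le_div_iff₀ (by positivity)]
      exact min_le_right _ _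
    nlinarith [mul_nonneg (mul_nonneg hr0.le hE0.le) (sub_nonneg.2 h1)]
  have hlim : Tendsto (fun n : ℕ => 4 * (2 * B) ^ 2 / r ^ 2 * ((n : ℝ) ^ (-(1 / 2) : ℝ) / ε n) ^ 2)
      atTop (𝓝 0) := by
    simpa using (hε_half.tendsto_div_nhds_zero.pow 2).const_mul (4 * (2 * B) ^ 2 / r ^ 2)
  refine tendsto_of_tendsto_of_tendsto_of_le_of_le' tendsto_const_nhds hlim
    (.of_forall fun n => measureReal_nonneg) ?_
  filter_upwards [eventually_ne_atTop 0] with n hn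
  have hεn := hε_pos n
  have hscale := (hspec.hasSum_scale hpos hεn f).tsum_eq
  change scale lam φ (ε n) f = _ at hscale
  have hcn := hc (ε n) hεn (hE n)
  obtain ⟨V, hVint, hV, hVle⟩ := exists_integrable_norm_empCovOp_sub_sq_le (P := P) hΦ hB hZ hZs
    hindep hident hn (tikhonovInv (covOp P fun ω => Φ (Z ω)) (ε n) f)
  rw [← hscale] at hVle
  have hsub : {ω | δ ≤ ‖empScale (fun i ω => Φ (Zs i ω)) (ε n) n f ω / scale lam φ (ε n) f - 1‖}
      ⊆ {ω | r ^ 2 * ε n ^ 2 * scale lam φ (ε n) f ≤ V ω} := by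
    intro ω hω
    by_contra hlt
    rw [Set.mem_ofPred_eq, not_le] at hlt
    have hp := abs_inner_tikhonovInv_sub_le hpos
      (inner_empCovOp_self_nonneg (ξ := fun i ω => Φ (Zs i ω)) n ω)
      (fun x y => by
        rw [inner_empCovOp, real_inner_comm, inner_empCovOp]
        simp_rw [mul_comm]) hεn f
    rw [← empScale_eq, ← hscale] at hp
    have hVω := (hV ω).trans_lt hlt
    set θ := scale lam φ (ε n) f
    set t := ‖empCovOp (fun i ω => Φ (Zs i ω)) n ω
        (tikhonovInv (covOp P fun ω => Φ (Z ω)) (ε n) f)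
      - covOp P (fun ω => Φ (Z ω)) (tikhonovInv (covOp P fun ω => Φ (Z ω)) (ε n) f)‖
    have hθ0 : 0 < θ := hc0.trans_le hcn
    have ht : t ≤ r * ε n * √θ := by
      refine le_of_sq_le_sq ?_ (by positivity)
      rw [mul_pow, mul_pow, Real.sq_sqrt hθ0.le]
      exact hVω.le
    have hfin : |empScale (fun i ω => Φ (Zs i ω)) (ε n) n f ω - θ| ≤ (a * r + r ^ 2 * E) * θ := by
      refine hp.trans ?_
      -- The bound on `t` supplies one factor `√θ`; the other comes from `√c ≤ √θ`.
      have h1 : 3 * (‖f‖ / ε n) * t ≤ a * r * θ := by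
        calc 3 * (‖f‖ / ε n) * t ≤ 3 * (‖f‖ / ε n) * (r * ε n * √θ) := by gcongr
          _ = 3 * ‖f‖ * r * √θ := by field_simp
          _ = 3 * ‖f‖ / √c * r * (√c * √θ) := by field_simp
          _ ≤ 3 * ‖f‖ / √c * r * (√θ * √θ) := by gcongr
          _ = a * r * θ := by rw [Real.mul_self_sqrt hθ0.le]
      have h2 : t ^ 2 / ε n ≤ r ^ 2 * E * θ := by
        calc t ^ 2 / ε n ≤ r ^ 2 * ε n ^ 2 * θ / ε n := by gcongr
          _ = r ^ 2 * ε n * θ := by field_simp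
          _ ≤ r ^ 2 * E * θ := by gcongr; exact hE n
      linarith
    rw [Set.mem_ofPred_eq, Real.norm_eq_abs, div_sub_one hθ0.ne', abs_div, abs_of_pos hθ0,
      le_div_iff₀ hθ0] at hω
    exact absurd (hω.trans hfin) (not_le.2 (mul_lt_mul_of_pos_right hrδ hθ0))
  have hθ0 : 0 < scale lam φ (ε n) f := hc0.trans_le hcn
  -- The threshold is proportional to `θ`, as is the bound on the expectation of `V`, so `θ` cancels
  -- and a multiple of `1 / (n ε²)` remains.
  have hmarkov := mul_meas_ge_le_integral_of_nonneg
    (.of_forall fun ω => (sq_nonneg _).trans (hV ω)) hVint (r ^ 2 * ε n ^ 2 * scale lam φ (ε n) f)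
  refine (measureReal_mono hsub).trans ?_
  have hroot : ((n : ℝ) ^ (-(1 / 2) : ℝ)) ^ 2 = (n : ℝ)⁻¹ := by
    rw [← Real.rpow_natCast, ← Real.rpow_mul n.cast_nonneg]
    norm_num [Real.rpow_neg_one]
  rw [div_pow, hroot]
  have hD : 0 < r ^ 2 * ε n ^ 2 * scale lam φ (ε n) f := by positivity
  refine ((le_div_iff₀' hD).2 (hmarkov.trans hVle)).trans_eq ?_
  field_simp

end Consistency

/-! ### Boundedness and continuity of kernel feature maps. -/

section Feature

variable {S : Type*} {κ : S → S → ℝ} {H : Type*} [NormedAddCommGroup H] [InnerProductSpace ℝ H]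
  [CompleteSpace H] [RKHS ℝ H S ℝ]

theorem Generates.inner_feature (h : Generates κ H) (x y : S) :
    inner ℝ (feature H x) (feature H y) = κ y x := by
  have := RKHS.kernel_inner H y x (1 : ℝ) (1 : ℝ)
  rw [h] at this
  simpa [feature] using this.symm

theorem Generates.norm_feature_le (h : Generates κ H) {C : ℝ} (hC : ∀ x y, |κ x y| ≤ C) (x : S) :
    ‖feature H x‖ ≤ √C := by
  refine Real.le_sqrt_of_sq_le ?_
  rw [← real_inner_self_eq_norm_sq, h.inner_feature]
  exact (le_abs_self _).trans (hC x x)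

/-- The squared distance of two features is `κ t t - 2 κ s t + κ s s`, which is continuous in `t`
and vanishes at `t = s`. -/
theorem Generates.continuous_feature [TopologicalSpace S] (h : Generates κ H)
    (hκ : Continuous fun p : S × S => κ p.1 p.2) : Continuous (feature H : S → H) := by
  rw [continuous_iff_continuousAt]
  intro s
  rw [ContinuousAt, tendsto_iff_norm_sub_tendsto_zero]
  have hsq (t : S) : ‖feature H t - feature H s‖ = √(κ t t - 2 * κ s t + κ s s) := by
    rw [← h.inner_feature t t, ← h.inner_feature t s, ← h.inner_feature s s,
      real_inner_self_eq_norm_sq, real_inner_self_eq_norm_sq, ← norm_sub_sq_real,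
      Real.sqrt_sq (norm_nonneg _)]
  simp_rw [hsq]
  have hcont : Continuous fun t => √(κ t t - 2 * κ s t + κ s s) := by
    have h1 : Continuous fun t => κ t t := hκ.comp (continuous_id.prodMk continuous_id)
    have h2 : Continuous fun t => κ s t := hκ.comp (continuous_const.prodMk continuous_id)
    fun_prop
  have := hcont.tendsto s
  have h0 : √(κ s s - 2 * κ s s + κ s s) = 0 := by
    rw [show κ s s - 2 * κ s s + κ s s = 0 by ring, Real.sqrt_zero]
  rwa [h0] at this

end Feature

end KernelScale

end

/-! ### The theorem for the kernels on `ΩX × ΩM` and on `ΩX`. -/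

theorem lemma4
    {Ω : Type*} [MeasurableSpace Ω] (P : Measure Ω) [IsProbabilityMeasure P]
    -- the separable metric spaces of the exposure and of the mediator
    {ΩX : Type*} [MetricSpace ΩX] [TopologicalSpace.SeparableSpace ΩX]
    [MeasurableSpace ΩX] [BorelSpace ΩX]
    {ΩM : Type*} [MetricSpace ΩM] [TopologicalSpace.SeparableSpace ΩM]
    [MeasurableSpace ΩM] [BorelSpace ΩM]
    -- bounded continuous kernels and the Hilbert spaces that they and their sum generate
    (κX : ΩX → ΩX → ℝ) (κM : ΩM → ΩM → ℝ)
    (hκX_cont : Continuous fun p : ΩX × ΩX => κX p.1 p.2)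
    (hκM_cont : Continuous fun p : ΩM × ΩM => κM p.1 p.2)
    (hκX_bdd : ∃ C : ℝ, ∀ x x', |κX x x'| ≤ C)
    (hκM_bdd : ∃ C : ℝ, ∀ m m', |κM m m'| ≤ C)
    {HX : Type*} [NormedAddCommGroup HX] [InnerProductSpace ℝ HX] [CompleteSpace HX]
    [RKHS ℝ HX ΩX ℝ] (hHX : KernelScale.Generates κX HX)
    {HM : Type*} [NormedAddCommGroup HM] [InnerProductSpace ℝ HM] [CompleteSpace HM]
    [RKHS ℝ HM ΩM ℝ] (_hHM : KernelScale.Generates κM HM)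
    {HZ : Type*} [NormedAddCommGroup HZ] [InnerProductSpace ℝ HZ] [CompleteSpace HZ]
    [RKHS ℝ HZ (ΩX × ΩM) ℝ] (hHZ : KernelScale.Generates (KernelScale.sumKernel κX κM) HZ)
    -- the pair `(X, M)` and an i.i.d. sample of it
    (X : Ω → ΩX) (M : Ω → ΩM) (hX : Measurable X) (hM : Measurable M)
    (Xs : ℕ → Ω → ΩX) (Ms : ℕ → Ω → ΩM)
    (hXs : ∀ i, Measurable (Xs i)) (hMs : ∀ i, Measurable (Ms i))
    (hindep : iIndepFun (fun i ω => (Xs i ω, Ms i ω)) P)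
    (hident : ∀ i, IdentDistrib (fun ω => (Xs i ω, Ms i ω)) (fun ω => (X ω, M ω)) P P)
    -- the eigenpairs of the covariance operators of `X` and of `Z = (X, M)`
    (lam : ℕ → ℝ) (φ : ℕ → HX)
    (hspecX : KernelScale.IsSpectralDecomposition
      (KernelScale.covOp P fun ω => KernelScale.feature HX (X ω)) lam φ)
    (lam' : ℕ → ℝ) (φ' : ℕ → HZ)
    (hspecZ : KernelScale.IsSpectralDecomposition
      (KernelScale.covOp P fun ω => KernelScale.feature HZ (X ω, M ω)) lam' φ')
    -- the regularization parameters and their rates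
    (η η' : ℝ) (hη : 0 < η ∧ η ≤ 1) (hη' : 0 < η' ∧ η' ≤ 1)
    (ε ε' : ℕ → ℝ) (hε_pos : ∀ n, 0 < ε n) (hε'_pos : ∀ n, 0 < ε' n)
    (hε_zero : Tendsto ε atTop (𝓝 0)) (hε'_zero : Tendsto ε' atTop (𝓝 0))
    (hε_half : (fun n : ℕ => (n : ℝ) ^ (-(1 / 2) : ℝ)) =o[atTop] ε)
    (hε'_half : (fun n : ℕ => (n : ℝ) ^ (-(1 / 2) : ℝ)) =o[atTop] ε')
    (hε_rate : (fun n : ℕ => (n : ℝ) ^ (-(3 / (4 * η + 4)))) =O[atTop] ε)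
    (hε'_rate : (fun n : ℕ => (n : ℝ) ^ (-(3 / (4 * η' + 4)))) =O[atTop] ε')
    (f : HZ) (g : HX)
    (hf : ∀ n, 0 < KernelScale.scale lam' φ' (ε' n) f)
    (hg : ∀ n, 0 < KernelScale.scale lam φ (ε n) g) :
    TendstoInMeasure P
        (fun n ω =>
          KernelScale.empScale (fun i ω => KernelScale.feature HZ (Xs i ω, Ms i ω)) (ε' n) n f ω
            / KernelScale.scale lam' φ' (ε' n) f)
        atTop (fun _ => (1 : ℝ)) ∧
      TendstoInMeasure P
        (fun n ω =>
          KernelScale.empScale (fun i ω => KernelScale.feature HX (Xs i ω)) (ε n) n g ω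
            / KernelScale.scale lam φ (ε n) g)
        atTop (fun _ => (1 : ℝ)) := by
  -- Second countability makes open sets of `ΩX × ΩM` measurable for the product σ-algebra and
  -- continuous feature maps strongly measurable.
  have hX2 := UniformSpace.secondCountable_of_separable ΩX
  have hM2 := UniformSpace.secondCountable_of_separable ΩM
  obtain ⟨CX, hCX⟩ := hκX_bdd
  obtain ⟨CM, hCM⟩ := hκM_bdd
  constructor
  · have hcont : Continuous fun p : (ΩX × ΩM) × (ΩX × ΩM) =>
        KernelScale.sumKernel κX κM p.1 p.2 :=
      (hκX_cont.comp (f := fun p : (ΩX × ΩM) × (ΩX × ΩM) => (p.1.1, p.2.1)) (by fun_prop)).add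
        (hκM_cont.comp (f := fun p : (ΩX × ΩM) × (ΩX × ΩM) => (p.1.2, p.2.2)) (by fun_prop))
    have hbdd (z z' : ΩX × ΩM) : |KernelScale.sumKernel κX κM z z'| ≤ CX + CM :=
      (abs_add_le _ _).trans (add_le_add (hCX _ _) (hCM _ _))
    exact KernelScale.tendstoInMeasure_empScale_div_scale
      (Z := fun ω => (X ω, M ω)) (Zs := fun i ω => (Xs i ω, Ms i ω))
      (hHZ.continuous_feature hcont).stronglyMeasurable
      (hHZ.norm_feature_le hbdd) (hX.prodMk hM) (fun i => (hXs i).prodMk (hMs i)) hindep hident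
      hspecZ hε'_pos hε'_zero hε'_half (hf 0)
  · exact KernelScale.tendstoInMeasure_empScale_div_scale
      (hHX.continuous_feature hκX_cont).stronglyMeasurable
      (hHX.norm_feature_le hCX) hX hXs (hindep.comp (fun _ => Prod.fst) fun _ => measurable_fst)
      (fun i => (hident i).comp measurable_fst) hspecX hε_pos hε_zero hε_half (hg 0)
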